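/- Let $p\ge 5$ be a prime. Let $B_0,B_1,B_2,\dots$ be the Bernoulli numbers, defined by $\frac{x}{e^x-1}=\sum_{k\ge 0}B_k\frac{x^k}{k!}$, and for rational numbers $a,b$ that are $p$-adic integers let $a\equiv b\pmod{p^k}$ mean that $a-b\in p^k\mathbb{Z}_p$, where $\mathbb{Z}_p$ is the ring of $p$-adic integers. Then both sides of the following congruences are $p$-adic integers, and $$\binom{2p-1}{p-1}-1\equiv-\frac23\,p^3B_{p-3}\pmod{p^4}$$ (Glaisher's congruence) and $$\binom{4p}{p}-\binom{4p-1}{2p-1}-1\equiv-\frac{48}{5}\,p^5B_{p-5}\pmod{p^6}.$$ -/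

import Mathlib

/-- Congruence `a ≡ b (mod p ^ k)` between rational numbers, in the ring `ℤ_[p]` of `p`-adic
integers: both `a` and `b` are `p`-adic integers, and `p ^ k` divides their difference
in `ℤ_[p]`. -/
def PadicIntModEq (p : ℕ) [Fact p.Prime] (k : ℕ) (a b : ℚ) : Prop :=
  ∃ x y : ℤ_[p], (x : ℚ_[p]) = (a : ℚ_[p]) ∧ (y : ℚ_[p]) = (b : ℚ_[p]) ∧
    (p : ℤ_[p]) ^ k ∣ x - y

/-!
Let `P = (X + 1)(X + 2)⋯(X + p - 1)`, with coefficients `c₀, c₁, …`. Since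
`((j + 1) p)! = (j p)! · P(j p) · (j + 1) p`, the binomial coefficients in both congruences are
quotients of products of values `P(j p)`, so everything reduces to expanding `P` in powers of `p`.

Two facts control the expansion. First, the symmetry `P(-p - x) = P(x)`
(`shiftedFactorial.eval_neg_sub`) determines the odd coefficients from the even ones up to the
required power of `p`. Secondly, `c_k` is the elementary symmetric function of degree `p - 1 - k`
in `1, …, p - 1`. By Faulhaber's formula the power sums of degree `m < p - 1` are
`p * bernoulli m` modulo `p ^ 2` (`PadicInt.sq_dvd_sum_pow_sub_mul_bernoulli`), and Newton's
identities, in which the mixed terms are divisible by `p ^ 2`, turn this into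
`(k + 1) c_k ≡ p * bernoulli (p - 1 - k)` modulo `p ^ 2`
(`PadicInt.sq_dvd_succ_mul_coeff_shiftedFactorial_sub`), for `p - 1 - k` even. The congruences come
from `k = 2` and from `k = 4` respectively. The second argument needs `p ≥ 7`, and the case `p = 5`
is a numerical identity.
-/

/-! ### Preliminaries on `p`-adic integers -/

theorem PadicInt.isUnit_natCast_of_lt {p : ℕ} [Fact p.Prime] {n : ℕ} (h0 : 0 < n) (hn : n < p) :
    IsUnit (n : ℤ_[p]) := by
  rw [PadicInt.isUnit_iff, PadicInt.norm_natCast_eq_one_iff]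
  exact ((Fact.out : p.Prime).coprime_iff_not_dvd).2 (Nat.not_dvd_of_pos_of_lt h0 hn)

theorem PadicInt.coe_ofNat {p : ℕ} [Fact p.Prime] (n : ℕ) [n.AtLeastTwo] :
    ((ofNat(n) : ℤ_[p]) : ℚ_[p]) = ofNat(n) :=
  PadicInt.coe_natCast n

theorem PadicInt.coe_eq_inv_of_natCast_mul_eq_one {p : ℕ} [Fact p.Prime] {n : ℕ} {u : ℤ_[p]}
    (h : (n : ℤ_[p]) * u = 1) : (u : ℚ_[p]) = ((n : ℚ_[p]))⁻¹ :=
  eq_inv_of_mul_eq_one_right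
    (by rw [← PadicInt.coe_natCast, ← PadicInt.coe_mul, h, PadicInt.coe_one])

/-! ### Bernoulli numbers and power sums modulo `p ^ 2` -/

/-- The recursion for `bernoulli' n` divides only by integers up to `n + 1 < p`, so no factor `p`
enters the denominators. -/
theorem Padic.norm_bernoulli'_le_one {p : ℕ} [Fact p.Prime] {n : ℕ} (hn : n < p - 1) :
    ‖((bernoulli' n : ℚ) : ℚ_[p])‖ ≤ 1 := by
  induction n using Nat.strong_induction_on with
  | _ n ih =>
  have hmem : ((bernoulli' n : ℚ) : ℚ_[p]) ∈ PadicInt.subring p := by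
    rw [bernoulli'_def]
    push_cast
    refine sub_mem (one_mem _) (sum_mem fun k hk ↦ mul_mem ?_ ?_)
    · have hk := Finset.mem_range.1 hk
      obtain ⟨u, hu⟩ := PadicInt.isUnit_natCast_of_lt (p := p) (n := n - k + 1)
        (by omega) (by omega)
      have h1 : ((u : ℤ_[p]) : ℚ_[p]) * ((↑u⁻¹ : ℤ_[p]) : ℚ_[p]) = 1 := by
        rw [← PadicInt.coe_mul, Units.mul_inv, PadicInt.coe_one]
      have h2 : ((u : ℤ_[p]) : ℚ_[p]) = (n : ℚ_[p]) - k + 1 := by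
        rw [hu]; push_cast [Nat.cast_sub hk.le]; ring
      rw [h2] at h1
      rw [div_eq_mul_inv, ← eq_inv_of_mul_eq_one_right h1]
      exact mul_mem (natCast_mem _ _) ((↑u⁻¹ : ℤ_[p]).2)
    · exact ih k (Finset.mem_range.1 hk) (by have := Finset.mem_range.1 hk; omega)
  exact hmem

theorem Padic.exists_padicInt_eq_bernoulli {p : ℕ} [Fact p.Prime] {n : ℕ} (hn : n < p - 1) :
    ∃ β : ℤ_[p], (β : ℚ_[p]) = ((bernoulli n : ℚ) : ℚ_[p]) := by
  refine ⟨⟨_, ?_⟩, rfl⟩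
  have h := Padic.norm_bernoulli'_le_one hn
  rw [bernoulli'_eq_bernoulli] at h
  simpa using h

/-- In Faulhaber's formula for the sum of the `m`-th powers below `p`, every term but the one with
`bernoulli m` carries a factor `p ^ 2`. -/
theorem PadicInt.sq_dvd_sum_pow_sub_mul_bernoulli {p : ℕ} [Fact p.Prime] {m : ℕ}
    (hm : m < p - 1) {β : ℤ_[p]} (hβ : (β : ℚ_[p]) = ((bernoulli m : ℚ) : ℚ_[p])) :
    (p : ℤ_[p]) ^ 2 ∣ ∑ k ∈ Finset.range p, (k : ℤ_[p]) ^ m - p * β := by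
  -- `b i` is a `p`-adic integer lift of `bernoulli i` for every `i < p - 1`.
  have hex : ∀ i, ∃ b : ℤ_[p], i < p - 1 → (b : ℚ_[p]) = ((bernoulli i : ℚ) : ℚ_[p]) := by
    intro i
    by_cases hi : i < p - 1
    · obtain ⟨b, hb⟩ := Padic.exists_padicInt_eq_bernoulli hi
      exact ⟨b, fun _ ↦ hb⟩
    · exact ⟨0, fun h ↦ absurd h hi⟩
  choose b hb using hex
  have hβm : b m = β := PadicInt.ext ((hb m hm).trans hβ.symm)
  have key : ((m + 1 : ℕ) : ℤ_[p]) * ∑ k ∈ Finset.range p, (k : ℤ_[p]) ^ m =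
      ∑ i ∈ Finset.range (m + 1), b i * ((m + 1).choose i : ℤ_[p]) * (p : ℤ_[p]) ^ (m + 1 - i) := by
    have hq : ((m + 1 : ℕ) : ℚ) * ∑ k ∈ Finset.range p, (k : ℚ) ^ m =
        ∑ i ∈ Finset.range (m + 1), bernoulli i * ((m + 1).choose i) * (p : ℚ) ^ (m + 1 - i) := by
      rw [sum_range_pow, Finset.mul_sum]
      refine Finset.sum_congr rfl fun i _ ↦ ?_
      push_cast
      field_simp
    have hq' := congrArg (fun q : ℚ ↦ (q : ℚ_[p])) hq
    apply PadicInt.ext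
    push_cast at hq'
    simp only [PadicInt.coe_mul, PadicInt.coe_sum, PadicInt.coe_pow, PadicInt.coe_natCast]
    push_cast
    rw [hq']
    refine Finset.sum_congr rfl fun i hi ↦ ?_
    rw [hb i (by have := Finset.mem_range.1 hi; omega)]
  rw [Finset.sum_range_succ, hβm] at key
  have hlow : (p : ℤ_[p]) ^ 2 ∣
      ∑ i ∈ Finset.range m, b i * ((m + 1).choose i : ℤ_[p]) * (p : ℤ_[p]) ^ (m + 1 - i) :=
    Finset.dvd_sum fun i hi ↦ Dvd.dvd.mul_left
      (pow_dvd_pow _ (by have := Finset.mem_range.1 hi; omega)) _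
  rw [← (PadicInt.isUnit_natCast_of_lt (p := p) (n := m + 1) (by omega) (by omega)).dvd_mul_left]
  convert hlow using 1
  rw [mul_sub, key, Nat.choose_succ_self_right, Nat.add_sub_cancel_left]
  ring

/-! ### Newton's identities modulo `d` and `d ^ 2` -/

theorem Multiset.dvd_mul_esymm_of_dvd_sum_pow {σ R : Type*} [Fintype σ] [CommRing R]
    (f : σ → R) {d : R} {m : ℕ} (hd : ∀ j, 0 < j → j ≤ m → d ∣ ∑ i, f i ^ j) :
    d ∣ m * (Finset.univ.val.map f).esymm m := by
  have h := congrArg (MvPolynomial.aeval f) (MvPolynomial.mul_esymm_eq_sum σ R m)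
  simp only [map_mul, map_sum, map_pow, map_neg, map_one, map_natCast,
    MvPolynomial.aeval_esymm_eq_multiset_esymm, MvPolynomial.psum, MvPolynomial.aeval_X] at h
  rw [h]
  refine Dvd.dvd.mul_left (Finset.dvd_sum fun a ha ↦ Dvd.dvd.mul_left (hd _ ?_ ?_) _) _ <;>
  · simp at ha; omega

/-- In Newton's identity, the terms other than `m * e_m` and the `m`-th power sum are products
`e_i * p_{m - i}` with `0 < i < m`, and both factors are divisible by `d`. -/
theorem Multiset.sq_dvd_mul_esymm_add_sum_pow {σ R : Type*} [Fintype σ] [CommRing R]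
    (f : σ → R) {d : R} {m : ℕ} (hm : 0 < m) (hd : ∀ j, 0 < j → j ≤ m → d ∣ ∑ i, f i ^ j)
    (he : ∀ j, 0 < j → j < m → d ∣ (Finset.univ.val.map f).esymm j) :
    d ^ 2 ∣ m * (Finset.univ.val.map f).esymm m + (-1) ^ m * ∑ i, f i ^ m := by
  have h := congrArg (MvPolynomial.aeval f) (MvPolynomial.psum_eq_mul_esymm_sub_sum σ R m hm)
  simp only [map_sub, map_mul, map_sum, map_pow, map_neg, map_one, map_natCast,
    MvPolynomial.aeval_esymm_eq_multiset_esymm, MvPolynomial.psum, MvPolynomial.aeval_X] at h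
  rw [h, mul_sub, ← mul_assoc, ← mul_assoc, ← pow_add, (by rw [Odd.neg_one_pow ⟨m, by ring⟩] :
    (-1 : R) ^ (m + (m + 1)) = -1), neg_one_mul, neg_mul, add_sub_assoc', add_neg_cancel, zero_sub,
    dvd_neg]
  refine Dvd.dvd.mul_left (Finset.dvd_sum fun a ha ↦ ?_) _
  simp at ha
  rw [sq]
  exact mul_dvd_mul (Dvd.dvd.mul_left (he _ (by omega) (by omega)) _) (hd _ (by omega) (by omega))

/-! ### The polynomial `(X + 1)(X + 2)⋯(X + n)` -/

section

open Polynomial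

theorem Polynomial.pow_dvd_eval_sub_sum {R : Type*} [CommRing R] (P : R[X]) (n : ℕ) (x : R) :
    x ^ n ∣ P.eval x - ∑ i ∈ Finset.range n, P.coeff i * x ^ i := by
  have h : X ^ n ∣ P - ∑ i ∈ Finset.range n, C (P.coeff i) * X ^ i := by
    rw [X_pow_dvd_iff]
    intro d hd
    simp [coeff_X_pow, finsetSum_coeff, hd]
  simpa [eval_finsetSum] using eval_dvd (x := x) h

/-- The polynomial `(X + 1)(X + 2)⋯(X + n)`. The index runs over `Fin n`, the form in which
Newton's identities give its coefficients. -/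
noncomputable def shiftedFactorial (R : Type*) [CommRing R] (n : ℕ) : R[X] :=
  ∏ i : Fin n, (X + C (((i : ℕ) : R) + 1))

namespace shiftedFactorial

theorem factorial_mul_eval_natCast (R : Type*) [CommRing R] (n m : ℕ) :
    (m.factorial : R) * (shiftedFactorial R n).eval (m : R) = ((m + n).factorial : R) := by
  rw [← Nat.factorial_mul_ascFactorial, Nat.ascFactorial_eq_prod_range, shiftedFactorial,
    eval_prod, Fin.prod_univ_eq_prod_range (fun i ↦ eval (m : R) (X + C ((i : R) + 1)))]
  push_cast
  congr 1
  refine Finset.prod_congr rfl fun i _ ↦ ?_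
  simp
  ring

/-- The substitution `i ↦ n + 1 - i` on the factors; evenness of `n` absorbs the signs. -/
theorem eval_neg_sub (R : Type*) [CommRing R] {n : ℕ} (hn : Even n) (x : R) :
    (shiftedFactorial R n).eval (-x - (n + 1)) = (shiftedFactorial R n).eval x := by
  simp only [shiftedFactorial, eval_prod, eval_add, eval_X, eval_C]
  rw [← Equiv.prod_comp Fin.revPerm]
  have : ∀ i : Fin n, -x - (n + 1) + (((Fin.revPerm i : Fin n) : R) + 1) =
      -(x + ((i : R) + 1)) := by
    intro i
    have : ((n - (i + 1) : ℕ) : R) = n - (i + 1) := by rw [Nat.cast_sub (by omega)]; push_cast; ring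
    rw [Fin.revPerm_apply, Fin.val_rev, this]
    ring
  simp only [this]
  rw [Finset.prod_neg, Finset.card_univ, Fintype.card_fin, hn.neg_one_pow, one_mul]

theorem coeff_eq_esymm (R : Type*) [CommRing R] {n k : ℕ} (hk : k ≤ n) :
    (shiftedFactorial R n).coeff k =
      ((Finset.univ : Finset (Fin n)).val.map fun i : Fin n ↦ ((i : ℕ) : R) + 1).esymm (n - k) := by
  have h := Multiset.prod_X_add_C_coeff' (Finset.univ : Finset (Fin n)).val
    (fun i : Fin n ↦ ((i : ℕ) : R) + 1) (k := k) (by simpa using hk)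
  rwa [Finset.card_val, Finset.card_univ, Fintype.card_fin] at h

end shiftedFactorial

end

/-! ### The case `n = p - 1` over the `p`-adic integers -/

namespace PadicInt

variable {p : ℕ} [Fact p.Prime]

theorem sum_fin_succ_pow {m : ℕ} (hm : 0 < m) :
    ∑ i : Fin (p - 1), (((i : ℕ) : ℤ_[p]) + 1) ^ m = ∑ k ∈ Finset.range p, (k : ℤ_[p]) ^ m := by
  have hp := (Fact.out : p.Prime).pos
  rw [Fin.sum_univ_eq_sum_range (fun i ↦ ((i : ℤ_[p]) + 1) ^ m)]
  have h := Finset.sum_range_succ' (fun k ↦ (k : ℤ_[p]) ^ m) (p - 1)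
  rw [Nat.sub_add_cancel hp] at h
  simp [h, hm.ne']

theorem dvd_sum_fin_succ_pow {m : ℕ} (h0 : 0 < m) (hm : m < p - 1) :
    (p : ℤ_[p]) ∣ ∑ i : Fin (p - 1), (((i : ℕ) : ℤ_[p]) + 1) ^ m := by
  obtain ⟨β, hβ⟩ := Padic.exists_padicInt_eq_bernoulli hm
  rw [sum_fin_succ_pow h0]
  have h := (dvd_pow_self (p : ℤ_[p]) two_ne_zero).trans (sq_dvd_sum_pow_sub_mul_bernoulli hm hβ)
  exact (dvd_sub_left (dvd_mul_right _ _)).1 h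

theorem dvd_coeff_shiftedFactorial {k : ℕ} (h0 : 0 < k) (hk : k < p - 1) :
    (p : ℤ_[p]) ∣ (shiftedFactorial ℤ_[p] (p - 1)).coeff k := by
  rw [shiftedFactorial.coeff_eq_esymm _ hk.le,
    ← (isUnit_natCast_of_lt (p := p) (n := p - 1 - k)
      (by omega) (by omega)).dvd_mul_left]
  exact Multiset.dvd_mul_esymm_of_dvd_sum_pow _
    fun j hj hj' ↦ dvd_sum_fin_succ_pow hj (by omega)

/-- The coefficient of `X ^ k` in `(X + 1)⋯(X + p - 1)` is congruent to
`p * bernoulli (p - 1 - k) / (k + 1)` modulo `p ^ 2`: Newton's identities with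
`m = p - 1 - k` express `m * c_k` through the `m`-th power sum, and `m * c_k ≡ -(k + 1) * c_k`
because `p` divides `c_k`. -/
theorem sq_dvd_succ_mul_coeff_shiftedFactorial_sub {k : ℕ} (h0 : 0 < k) (hk : k < p - 1)
    (heven : Even (p - 1 - k)) {β : ℤ_[p]}
    (hβ : (β : ℚ_[p]) = ((bernoulli (p - 1 - k) : ℚ) : ℚ_[p])) :
    (p : ℤ_[p]) ^ 2 ∣ (k + 1) * (shiftedFactorial ℤ_[p] (p - 1)).coeff k - p * β := by
  have h := Multiset.sq_dvd_mul_esymm_add_sum_pow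
    (fun i : Fin (p - 1) ↦ ((i : ℕ) : ℤ_[p]) + 1) (d := (p : ℤ_[p])) (m := p - 1 - k) (by omega)
    (fun j hj hj' ↦ dvd_sum_fin_succ_pow hj (by omega)) fun j hj hj' ↦ by
      have h := dvd_coeff_shiftedFactorial (p := p) (k := p - 1 - j) (by omega) (by omega)
      rwa [shiftedFactorial.coeff_eq_esymm _ (by omega),
        (by omega : p - 1 - (p - 1 - j) = j)] at h
  rw [← shiftedFactorial.coeff_eq_esymm _ hk.le, heven.neg_one_pow, one_mul,
    sum_fin_succ_pow (by omega)] at h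
  have hcast : ((p - 1 - k : ℕ) : ℤ_[p]) = p - (k + 1) := by
    rw [Nat.sub_sub, Nat.cast_sub (by omega)]; push_cast; ring
  rw [hcast] at h
  obtain ⟨u, hu⟩ := h
  obtain ⟨v, hv⟩ := sq_dvd_sum_pow_sub_mul_bernoulli (by omega : p - 1 - k < p - 1) hβ
  obtain ⟨w, hw⟩ := dvd_coeff_shiftedFactorial h0 hk
  exact ⟨w + v - u, by linear_combination -hu + hv + (p : ℤ_[p]) * hw⟩

theorem dvd_factorial_add_one : (p : ℤ_[p]) ∣ ((p - 1).factorial : ℤ_[p]) + 1 := by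
  have h : p ∣ (p - 1).factorial + 1 := by
    rw [← ZMod.natCast_eq_zero_iff]
    push_cast
    rw [ZMod.wilsons_lemma]
    ring
  exact_mod_cast Nat.cast_dvd_cast (α := ℤ_[p]) h

theorem coeff_zero_shiftedFactorial :
    (shiftedFactorial ℤ_[p] (p - 1)).coeff 0 = ((p - 1).factorial : ℤ_[p]) := by
  have h := shiftedFactorial.factorial_mul_eval_natCast ℤ_[p] (p - 1) 0
  simpa [Polynomial.coeff_zero_eq_eval_zero] using h

theorem factorial_succ_mul (j : ℕ) :
    (((j + 1) * p).factorial : ℤ_[p]) = (j + 1) * p * ((j * p).factorial *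
      (shiftedFactorial ℤ_[p] (p - 1)).eval ((j * p : ℕ) : ℤ_[p])) := by
  have hp := (Fact.out : p.Prime).pos
  rw [shiftedFactorial.factorial_mul_eval_natCast,
    (by rw [add_mul, one_mul]; omega : (j + 1) * p = (j * p + (p - 1)) + 1), Nat.factorial_succ]
  rw [(by rw [add_mul, one_mul]; omega : (j * p + (p - 1)) + 1 = (j + 1) * p)]
  push_cast
  ring

theorem factorial_mul_sub_one (j : ℕ) :
    (((j + 1) * p - 1).factorial : ℤ_[p]) = (j * p).factorial *
      (shiftedFactorial ℤ_[p] (p - 1)).eval ((j * p : ℕ) : ℤ_[p]) := by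
  have hp := (Fact.out : p.Prime).pos
  rw [shiftedFactorial.factorial_mul_eval_natCast,
    (by rw [add_mul, one_mul]; omega : (j + 1) * p - 1 = j * p + (p - 1))]

theorem shiftedFactorial_eval_neg_sub (hp : p ≠ 2) (x : ℤ_[p]) :
    (shiftedFactorial ℤ_[p] (p - 1)).eval (-x - p) = (shiftedFactorial ℤ_[p] (p - 1)).eval x := by
  have hpos := (Fact.out : p.Prime).pos
  have h := shiftedFactorial.eval_neg_sub ℤ_[p]
    ((Fact.out : p.Prime).even_sub_one hp) x
  rwa [Nat.cast_sub hpos, Nat.cast_one, sub_add_cancel] at h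

theorem natCast_ne_zero {n : ℕ} (h : n ≠ 0) : (n : ℤ_[p]) ≠ 0 := Nat.cast_ne_zero.2 h

end PadicInt

/-! ### The congruences -/

open PadicInt in
/-- Glaisher's congruence. With `P = (X + 1)⋯(X + p - 1)` and coefficients `cᵢ`, the binomial
coefficient is `P(p) / c₀`. Since `P(-p) = c₀`, the odd part of `P(p)` equals `c₂ p²` modulo `p⁴`,
so that `P(p) ≡ c₀ + 2 c₂ p²`. -/
theorem choose_two_mul_prime_sub_one_modEq (p : ℕ) [Fact p.Prime] (hp : 5 ≤ p) :
    PadicIntModEq p 4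
      (((2 * p - 1).choose (p - 1) : ℚ) - 1)
      (-(2 / 3 : ℚ) * (p : ℚ) ^ 3 * bernoulli (p - 3)) := by
  obtain ⟨β, hβ⟩ := Padic.exists_padicInt_eq_bernoulli (p := p) (n := p - 3) (by omega)
  obtain ⟨u, hu⟩ := (isUnit_natCast_of_lt (p := p) (n := 3) (by omega) (by omega)).exists_right_inv
  refine ⟨((2 * p - 1).choose (p - 1) : ℤ_[p]) - 1, -2 * u * p ^ 3 * β, by push_cast; rfl, ?_, ?_⟩
  · have hu' := coe_eq_inv_of_natCast_mul_eq_one hu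
    push_cast [coe_ofNat]
    rw [hu', hβ]
    push_cast
    ring
  set P := shiftedFactorial ℤ_[p] (p - 1) with hP
  set A : ℤ_[p] := ((2 * p - 1).choose (p - 1) : ℤ_[p])
  have hA' : A * P.coeff 0 = P.eval (p : ℤ_[p]) := by
    have h := Nat.choose_mul_factorial_mul_factorial (n := 2 * p - 1) (k := p - 1) (by omega)
    rw [(by omega : 2 * p - 1 - (p - 1) = p)] at h
    have h' := congrArg (Nat.cast : ℕ → ℤ_[p]) h
    have h1 := factorial_mul_sub_one (p := p) 1
    rw [one_add_one_eq_two, one_mul] at h1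
    push_cast at h'
    rw [h1, ← coeff_zero_shiftedFactorial] at h'
    refine mul_right_cancel₀ (natCast_ne_zero (p := p) p.factorial_ne_zero) ?_
    rw [h', mul_comm]
  obtain ⟨r, hr⟩ := P.pow_dvd_eval_sub_sum 4 (p : ℤ_[p])
  obtain ⟨s, hs⟩ := P.pow_dvd_eval_sub_sum 4 (-p : ℤ_[p])
  have hsymm : P.eval (-p : ℤ_[p]) = P.coeff 0 := by
    rw [Polynomial.coeff_zero_eq_eval_zero, ← shiftedFactorial_eval_neg_sub (by omega), neg_neg,
      sub_self]
  obtain ⟨w, hw⟩ := dvd_factorial_add_one (p := p)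
  rw [← coeff_zero_shiftedFactorial, ← hP] at hw
  obtain ⟨v, hv⟩ := sq_dvd_succ_mul_coeff_shiftedFactorial_sub (p := p) (k := 2) (by omega)
    (by omega) (by
      obtain ⟨t, ht⟩ := (Fact.out : p.Prime).even_sub_one (by omega)
      exact ⟨t - 1, by omega⟩)
    (β := β) (by rw [hβ, (by omega : p - 3 = p - 1 - 2)])
  rw [← hP] at hv
  simp only [Finset.sum_range_succ, Finset.sum_range_zero] at hr hs
  rw [← hA'] at hr
  rw [hsymm] at hs
  push_cast at hu hv
  -- The left side is multiplied by the unit `P.coeff 0 ≡ -1` (Wilson).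
  have hcop : IsCoprime ((p : ℤ_[p]) ^ 4) (P.coeff 0) :=
    IsCoprime.pow_left ⟨w, -1, by linear_combination -hw⟩
  refine hcop.dvd_of_dvd_mul_left ⟨r + s + 2 * u * v + 2 * u * w * β, ?_⟩
  linear_combination hr + hs + 2 * u * p ^ 2 * hv - 2 * (P.coeff 2) * p ^ 2 * hu
    + 2 * u * p ^ 3 * β * hw

open PadicInt in
/-- With `P = (X + 1)⋯(X + p - 1)` and coefficients `cᵢ`, the two binomial coefficients
`A` and `B` satisfy `A c₀ = 4 P(3p)` and `B c₀ P(p) = 3 P(2p) P(3p)`. The symmetry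
`P(-p - x) = P(x)` gives `P(jp) ≡ c₀ + a t + b t²` modulo `p⁶`, where `t = j (j + 1)`,
`b = c₄ p⁴` and `a = c₂ p² - b`. As `p³` divides `a` and `p⁵` divides `b`, the quadratic terms
vanish in
`(A - B - 1) c₀ P(p) = 4 P(p) P(3p) - 3 P(2p) P(3p) - c₀ P(p)`, the multiples of `a` cancel, and
`48 c₀ b` remains. For `p = 5` the bound `p ∣ c₄` fails. -/
theorem choose_four_mul_prime_sub_choose_modEq (p : ℕ) [Fact p.Prime] (hp : 7 ≤ p) :
    PadicIntModEq p 6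
      (((4 * p).choose p : ℚ) - ((4 * p - 1).choose (2 * p - 1) : ℚ) - 1)
      (-(48 / 5 : ℚ) * (p : ℚ) ^ 5 * bernoulli (p - 5)) := by
  obtain ⟨β, hβ⟩ := Padic.exists_padicInt_eq_bernoulli (p := p) (n := p - 5) (by omega)
  obtain ⟨u, hu⟩ := (isUnit_natCast_of_lt (p := p) (n := 5) (by omega) (by omega)).exists_right_inv
  refine ⟨((4 * p).choose p : ℤ_[p]) - ((4 * p - 1).choose (2 * p - 1) : ℤ_[p]) - 1,
    -48 * u * p ^ 5 * β, by push_cast; rfl, ?_, ?_⟩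
  · have hu' := coe_eq_inv_of_natCast_mul_eq_one hu
    push_cast [coe_ofNat]
    rw [hu', hβ]
    push_cast
    ring
  set P := shiftedFactorial ℤ_[p] (p - 1) with hP
  set A : ℤ_[p] := ((4 * p).choose p : ℤ_[p])
  set B : ℤ_[p] := ((4 * p - 1).choose (2 * p - 1) : ℤ_[p])
  have hf0 := factorial_succ_mul (p := p) 0
  have hf2 := factorial_succ_mul (p := p) 2
  have hf3 := factorial_succ_mul (p := p) 3
  have hg1 := factorial_mul_sub_one (p := p) 1
  have hg3 := factorial_mul_sub_one (p := p) 3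
  simp only [Nat.reduceAdd, zero_add, one_mul, zero_mul, Nat.factorial_zero, Nat.cast_zero,
    Nat.cast_one, one_mul, ← Polynomial.coeff_zero_eq_eval_zero, ← hP] at hf0 hf2 hf3 hg1 hg3
  push_cast at hf0 hf2 hf3 hg1 hg3
  have hA' : A * P.coeff 0 = 4 * P.eval (3 * p : ℤ_[p]) := by
    have h := congrArg (Nat.cast : ℕ → ℤ_[p])
      (Nat.choose_mul_factorial_mul_factorial (n := 4 * p) (k := p) (by omega))
    rw [(by omega : 4 * p - p = 3 * p)] at h
    push_cast at h
    refine mul_right_cancel₀ (mul_ne_zero (natCast_ne_zero (p := p) (3 * p).factorial_ne_zero)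
      (natCast_ne_zero (p := p) (by omega : p ≠ 0))) ?_
    linear_combination h + hf3 - A * (3 * p).factorial * hf0
  have hB' : B * P.coeff 0 * P.eval (p : ℤ_[p]) =
      3 * P.eval (2 * p : ℤ_[p]) * P.eval (3 * p : ℤ_[p]) := by
    have h := congrArg (Nat.cast : ℕ → ℤ_[p])
      (Nat.choose_mul_factorial_mul_factorial (n := 4 * p - 1) (k := 2 * p - 1) (by omega))
    rw [(by omega : 4 * p - 1 - (2 * p - 1) = 2 * p)] at h
    push_cast at h
    refine mul_right_cancel₀ (mul_ne_zero (natCast_ne_zero (p := p) (2 * p).factorial_ne_zero)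
      (natCast_ne_zero (p := p) (by omega : p ≠ 0))) ?_
    linear_combination h + hg3 + P.eval (3 * p : ℤ_[p]) * hf2
      - B * (2 * p).factorial * hg1 - B * (2 * p).factorial * P.eval (p : ℤ_[p]) * hf0
  have hc : ∀ k, 0 < k → k < p - 1 → (p : ℤ_[p]) ∣ P.coeff k :=
    fun k h h' ↦ dvd_coeff_shiftedFactorial h h'
  obtain ⟨d2, hd2⟩ := hc 2 (by omega) (by omega)
  obtain ⟨d4, hd4⟩ := hc 4 (by omega) (by omega)
  obtain ⟨d5, hd5⟩ := hc 5 (by omega) (by omega)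
  -- The term of degree `5` drops out because `p` divides its coefficient.
  have hexp : ∀ j : ℤ_[p], ∃ r, P.eval (j * p) = P.coeff 0 + P.coeff 1 * (j * p)
      + P.coeff 2 * (j * p) ^ 2 + P.coeff 3 * (j * p) ^ 3 + P.coeff 4 * (j * p) ^ 4
      + p ^ 6 * r := by
    intro j
    obtain ⟨r, hr⟩ := P.pow_dvd_eval_sub_sum 6 (j * p)
    simp only [Finset.sum_range_succ, Finset.sum_range_zero] at hr
    exact ⟨j ^ 6 * r + d5 * j ^ 5, by linear_combination hr + (j * p) ^ 5 * hd5⟩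
  have hsymm1 : P.eval (-1 * p : ℤ_[p]) = P.coeff 0 := by
    rw [Polynomial.coeff_zero_eq_eval_zero, ← shiftedFactorial_eval_neg_sub (by omega), neg_one_mul,
      neg_neg, sub_self]
  have hsymm2 : P.eval (-2 * p : ℤ_[p]) = P.eval (1 * p : ℤ_[p]) := by
    rw [← shiftedFactorial_eval_neg_sub (by omega) (1 * p), hP]
    ring_nf
  obtain ⟨r1, hr1⟩ := hexp (-1)
  obtain ⟨r2, hr2⟩ := hexp (-2)
  obtain ⟨r3, hr3⟩ := hexp 1
  rw [hsymm1] at hr1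
  rw [hsymm2] at hr2
  have hu6 : IsUnit (6 : ℤ_[p]) := isUnit_natCast_of_lt (n := 6) (by omega) (by omega)
  -- The symmetry at `0` and at `p` determines the odd coefficients modulo `p ^ 6`.
  have hW : (p : ℤ_[p]) ^ 6 ∣ P.coeff 3 * p ^ 3 - 2 * P.coeff 4 * p ^ 4 := by
    rw [← hu6.dvd_mul_left]
    exact ⟨r2 - r3 - 3 * r1, by linear_combination hr2 - hr3 - 3 * hr1⟩
  obtain ⟨W, hW⟩ := hW
  set a' : ℤ_[p] := d2 - d4 * p ^ 2 with ha'
  -- The coefficients of `j` and `j ^ 3` are now replaced by those of `a * t + b * t ^ 2`.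
  have hquad : ∀ j : ℤ_[p], ∃ r, P.eval (j * p) = P.coeff 0 + p ^ 3 * a' * (j * (j + 1))
      + p ^ 5 * d4 * (j * (j + 1)) ^ 2 + p ^ 6 * r := by
    intro j
    obtain ⟨r, hr⟩ := hexp j
    refine ⟨r + j * r1 - j * W + j ^ 3 * W, ?_⟩
    rw [hr, ha']
    linear_combination j * hr1 + (j ^ 3 - j) * hW + (p ^ 2 * (j ^ 2 + j)) * hd2
      + (p ^ 4 * (j ^ 4 + 2 * j ^ 3 - j)) * hd4
  obtain ⟨s1, hs1⟩ := hquad 1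
  obtain ⟨s2, hs2⟩ := hquad 2
  obtain ⟨s3, hs3⟩ := hquad 3
  rw [one_mul] at hs1
  rw [hs3] at hA'
  rw [hs1, hs2, hs3] at hB'
  obtain ⟨w, hw⟩ := dvd_factorial_add_one (p := p)
  rw [← coeff_zero_shiftedFactorial, ← hP] at hw
  obtain ⟨v, hv⟩ := sq_dvd_succ_mul_coeff_shiftedFactorial_sub (p := p) (k := 4) (by omega)
    (by omega) (by
      obtain ⟨t, ht⟩ := (Fact.out : p.Prime).even_sub_one (by omega)
      exact ⟨t - 2, by omega⟩)
    (β := β) (by rw [hβ, (by omega : p - 5 = p - 1 - 4)])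
  rw [← hP] at hv
  push_cast at hu hv
  set q : ℤ_[p] := (p : ℤ_[p])
  set x := w + 2 * q ^ 2 * a' + 4 * q ^ 4 * d4 + q ^ 5 * s1 with hx
  -- The factors `P.coeff 0` and `P.eval q` are `-1` modulo `p`, hence can be cancelled.
  have hcop0 : IsCoprime (q ^ 6) (P.coeff 0) :=
    IsCoprime.pow_left ⟨w, -1, by linear_combination -hw⟩
  have hx' : P.eval q = -1 + q * x := by
    rw [hs1, hx]
    linear_combination hw
  have hcop1 : IsCoprime (q ^ 6) (P.eval q) :=
    IsCoprime.pow_left ⟨x, -1, by linear_combination -hx'⟩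
  -- In the quotient, the first two lines are the terms of degree two in `a` and `b`, those with
  -- `s1`, `s2`, `s3` collect the remainders, and those with `u` compare `c₄` with the lift `β` of
  -- `bernoulli (p - 5)`.
  refine hcop0.dvd_of_dvd_mul_left (hcop1.dvd_of_dvd_mul_left ⟨
    4 * (2 * a' + 4 * q ^ 2 * d4) * (12 * a' + 144 * q ^ 2 * d4)
    - 3 * (6 * a' + 36 * q ^ 2 * d4) * (12 * a' + 144 * q ^ 2 * d4)
    + 4 * (s1 * P.eval (3 * q) + (P.eval q - q ^ 6 * s1) * s3)
    - 3 * (s2 * P.eval (3 * q) + (P.eval (2 * q) - q ^ 6 * s2) * s3)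
    - P.coeff 0 * s1 + 48 * P.coeff 0 * u * β * x + 48 * P.coeff 0 * u * v, ?_⟩)
  rw [hs1] at hx'
  rw [hs1, hs2, hs3]
  linear_combination (P.coeff 0 + q ^ 3 * a' * (1 * (1 + 1)) + q ^ 5 * d4 * (1 * (1 + 1)) ^ 2
      + q ^ 6 * s1) * hA' - hB' + 48 * P.coeff 0 * u * q ^ 5 * β * hx'
    + 48 * P.coeff 0 * q ^ 4 * (u * hv - P.coeff 4 * hu - hd4)

theorem corollary1p4 (p : ℕ) [Fact p.Prime] (hp : 5 ≤ p) :
    PadicIntModEq p 4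
      (((2 * p - 1).choose (p - 1) : ℚ) - 1)
      (-(2 / 3 : ℚ) * (p : ℚ) ^ 3 * bernoulli (p - 3)) ∧
    PadicIntModEq p 6
      (((4 * p).choose p : ℚ) - ((4 * p - 1).choose (2 * p - 1) : ℚ) - 1)
      (-(48 / 5 : ℚ) * (p : ℚ) ^ 5 * bernoulli (p - 5)) := by
  refine ⟨choose_two_mul_prime_sub_one_modEq p hp, ?_⟩
  rcases hp.eq_or_lt with rfl | hlt
  · -- For `p = 5` the two sides are `-76875` and `-30000`, which differ by `3 * 5 ^ 6`.
    refine ⟨(-76875 : ℤ), (-30000 : ℤ), ?_, ?_, ⟨(-3 : ℤ), by norm_num⟩⟩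
    · rw [PadicInt.coe_intCast, ← Rat.cast_intCast]
      congr 1
      norm_num [Nat.choose]
    · rw [PadicInt.coe_intCast, ← Rat.cast_intCast]
      congr 1
      norm_num
  · have h6 : p ≠ 6 := fun h ↦ absurd (h ▸ (Fact.out : p.Prime)) (by norm_num)
    exact choose_four_mul_prime_sub_choose_modEq p (by omega)
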